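/- **Theorem 2.5.** Let $A=(a_{ij})$ be a $d\times n$ integer matrix with columns $a_1,\dots,a_n$ that span $\mathbb{Z}^d$ over $\mathbb{Z}$ (so $A$ has rank $d$) and that all lie in an open half-space of $\mathbb{R}^d$. Let $D$ be the complex Weyl algebra in $x_1,\dots,x_n,\partial_1,\dots,\partial_n$, put $\theta_j=x_j\partial_j$, and for $\beta\in\mathbb{C}^d$ let $H_A(\beta)\subseteq D$ be the left ideal generated by all $\partial^u-\partial^v$ with $u,v\in\mathbb{N}^n$, $Au=Av$, and by the operators $\sum_{j=1}^n a_{ij}\theta_j-\beta_i$, $i=1,\dots,d$. A *facet* of $A$ is a maximal set $\sigma$ among the sets of columns of the form $\{a_j : h(a_j)=0\}$, where $h$ is a nonzero linear functional on $\mathbb{Z}^d$ with $h(a_k)\ge 0$ for all $k$ (that is, $\sigma$ is the set of columns on a facet of the cone $\mathbb{R}_{\ge 0}A$). Its *primitive support function* $\nu_\sigma$ is the rational linear form with $\nu_\sigma(\mathbb{Z}A)=\mathbb{Z}$, $\nu_\sigma(a_j)\ge 0$ for all $j$, and $\nu_\sigma(a_j)=0$ for $a_j\in\sigma$. The parameter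 $\beta$ is *nonresonant* if $\nu_\sigma(\beta)\notin\mathbb{Z}$ for every facet $\sigma$ of $A$. A formal series $f$ is *fully supported* if it is of the form $f=x^v\sum_{u\in L}\lambda_u x^u$ with $v\in\mathbb{C}^n$, $L\subseteq\mathbb{Z}^n$ a lattice (subgroup) and $\lambda_u\in\mathbb{C}$, and its support $\{v+u : u\in L,\ \lambda_u\ne 0\}$ is Zariski dense in the Zariski closure of $v+L$ in $\mathbb{C}^n$. The algebra $D$ acts on such series termwise. Let $\beta$ be nonresonant and let $f$ be a fully supported solution of $H_A(\beta)$, i.e. $Qf=0$ for all $Q\in H_A(\beta)$. If $P\in D$ satisfies $Pf=0$, then $P\in H_A(\beta)$. Consequently $H_A(\beta)=\{P\in D : Pf=0\}$ is the differential annihilator of the single function $f$. -/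

import Mathlib

noncomputable section

namespace AHyp

/-! ### The Weyl algebra -/

/-- Defining relations of the Weyl algebra on the free algebra with generators
`Sum.inl i` (the variable `x_i`) and `Sum.inr i` (the derivation `∂_i`). -/
inductive WeylRel (n : ℕ) :
    FreeAlgebra ℂ (Fin n ⊕ Fin n) → FreeAlgebra ℂ (Fin n ⊕ Fin n) → Prop
  | xx (i j : Fin n) : WeylRel n
      (FreeAlgebra.ι ℂ (Sum.inl i) * FreeAlgebra.ι ℂ (Sum.inl j))
      (FreeAlgebra.ι ℂ (Sum.inl j) * FreeAlgebra.ι ℂ (Sum.inl i))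
  | dd (i j : Fin n) : WeylRel n
      (FreeAlgebra.ι ℂ (Sum.inr i) * FreeAlgebra.ι ℂ (Sum.inr j))
      (FreeAlgebra.ι ℂ (Sum.inr j) * FreeAlgebra.ι ℂ (Sum.inr i))
  | dx (i j : Fin n) : WeylRel n
      (FreeAlgebra.ι ℂ (Sum.inr i) * FreeAlgebra.ι ℂ (Sum.inl j))
      (FreeAlgebra.ι ℂ (Sum.inl j) * FreeAlgebra.ι ℂ (Sum.inr i) + if i = j then 1 else 0)

/-- The complex Weyl algebra `D = D_n`. -/
abbrev Weyl (n : ℕ) : Type := RingQuot (WeylRel n)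

variable {n d : ℕ}

/-- The variable `x_i` in the Weyl algebra. -/
def X (i : Fin n) : Weyl n :=
  RingQuot.mkAlgHom ℂ (WeylRel n) (FreeAlgebra.ι ℂ (Sum.inl i))

/-- The derivation `∂_i` in the Weyl algebra. -/
def del (i : Fin n) : Weyl n :=
  RingQuot.mkAlgHom ℂ (WeylRel n) (FreeAlgebra.ι ℂ (Sum.inr i))

/-- `θ_i = x_i ∂_i`. -/
def theta (i : Fin n) : Weyl n := X i * del i

/-- The monomial `∂^u = ∂_1^{u_1} ⋯ ∂_n^{u_n}`. -/
def delPow (u : Fin n → ℕ) : Weyl n := (List.ofFn fun j => del j ^ u j).prod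

/-! ### The hypergeometric system -/

/-- The image in the Weyl algebra of the generators `∂^u - ∂^v`, `Au = Av`, of the toric ideal. -/
def toricBinomials (A : Matrix (Fin d) (Fin n) ℤ) : Set (Weyl n) :=
  {P | ∃ u v : Fin n → ℕ,
    A.mulVec (fun j => (u j : ℤ)) = A.mulVec (fun j => (v j : ℤ)) ∧ P = delPow u - delPow v}

/-- The Euler operator `E_i = ∑_j a_{ij} θ_j`. -/
def euler (A : Matrix (Fin d) (Fin n) ℤ) (i : Fin d) : Weyl n :=
  ∑ j, (A i j : ℂ) • theta j

/-- The `A`-hypergeometric system `H_A(β)`: the left ideal of the Weyl algebra generated by the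
toric ideal and the operators `E_i - β_i`.  (`Ideal` of a noncommutative ring means left ideal.) -/
def hypergeometricIdeal (A : Matrix (Fin d) (Fin n) ℤ) (β : Fin d → ℂ) : Ideal (Weyl n) :=
  Ideal.span (toricBinomials A) ⊔
    Ideal.span (Set.range fun i => euler A i - algebraMap ℂ (Weyl n) (β i))

/-! ### Facets, primitive support functions, nonresonance -/

/-- The value `∑_i h_i a_{ij}` of the integral linear functional `h` at the column `a_j`. -/
def colVal (A : Matrix (Fin d) (Fin n) ℤ) (h : Fin d → ℤ) (j : Fin n) : ℤ :=
  ∑ i, h i * A i j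

/-- `σ` is the set of (indices of) columns on a proper face of the cone `ℝ_{≥0} A`: the columns
at which some nonzero linear functional attains its minimum over the cone (this minimum is
attained at the origin, so it is `0`). -/
def IsFace (A : Matrix (Fin d) (Fin n) ℤ) (σ : Set (Fin n)) : Prop :=
  ∃ h : Fin d → ℤ, h ≠ 0 ∧ (∀ j, 0 ≤ colVal A h j) ∧ σ = {j | colVal A h j = 0}

/-- A facet of `A`: a maximal proper face. -/
def IsFacet (A : Matrix (Fin d) (Fin n) ℤ) (σ : Set (Fin n)) : Prop :=
  Maximal (IsFace A) σ

/-- The rational linear form with coefficient vector `ν` is the primitive support function of the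
facet `σ`: it maps `ℤA` onto `ℤ`, is nonnegative on all columns, and vanishes on `σ`. -/
structure IsPrimitiveSupport (A : Matrix (Fin d) (Fin n) ℤ) (σ : Set (Fin n))
    (ν : Fin d → ℚ) : Prop where
  image_eq : Set.range (fun u : Fin n → ℤ => ∑ i, ν i * ((A.mulVec u i : ℤ) : ℚ)) =
    Set.range (fun k : ℤ => (k : ℚ))
  nonneg : ∀ j, 0 ≤ ∑ i, ν i * (A i j : ℚ)
  eq_zero : ∀ j ∈ σ, ∑ i, ν i * (A i j : ℚ) = 0

/-- `β` is nonresonant: `ν_σ(β) ∉ ℤ` for all facets `σ` of `A`. -/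
def Nonresonant (A : Matrix (Fin d) (Fin n) ℤ) (β : Fin d → ℂ) : Prop :=
  ∀ σ : Set (Fin n), IsFacet A σ → ∀ ν : Fin d → ℚ, IsPrimitiveSupport A σ ν →
    ∀ k : ℤ, ∑ i, (ν i : ℂ) * β i ≠ (k : ℂ)

/-! ### Formal series and the action of the Weyl algebra -/

/-- Formal series `∑_w f(w) x^w` with complex exponent vectors `w ∈ ℂ^n`. -/
abbrev Series (n : ℕ) : Type := (Fin n → ℂ) → ℂ

/-- Multiplication by `x_i`: `x_i · x^w = x^{w + e_i}`. -/
def mulX (i : Fin n) : Module.End ℂ (Series n) where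
  toFun f := fun w => f (w - Pi.single i 1)
  map_add' _ _ := rfl
  map_smul' _ _ := rfl

/-- Differentiation by `x_i`: `∂_i x^w = w_i x^{w - e_i}`. -/
def diff (i : Fin n) : Module.End ℂ (Series n) where
  toFun f := fun w => (w i + 1) * f (w + Pi.single i 1)
  map_add' f g := by funext w; simp [mul_add]
  map_smul' c f := by funext w; simp [mul_left_comm]

/-- The assignment `x_i ↦ mulX i`, `∂_i ↦ diff i` on the free algebra. -/
def freeAction (n : ℕ) : FreeAlgebra ℂ (Fin n ⊕ Fin n) →ₐ[ℂ] Module.End ℂ (Series n) :=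
  FreeAlgebra.lift ℂ (Sum.elim mulX diff)

theorem freeAction_rel {a b : FreeAlgebra ℂ (Fin n ⊕ Fin n)} (h : WeylRel n a b) :
    freeAction n a = freeAction n b := by
  cases h with
  | xx i j =>
    ext f w
    simp [freeAction, mulX, sub_right_comm]
  | dd i j =>
    ext f w
    by_cases hij : i = j
    · subst hij; rfl
    · have hji : j ≠ i := fun h => hij h.symm
      simp [freeAction, diff, hij, hji, add_right_comm]
      ring
  | dx i j =>
    ext f w
    by_cases hij : i = j
    · subst hij
      simp [freeAction, diff, mulX]
      ring
    · simp [freeAction, diff, mulX, hij, add_sub_right_comm]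

/-- The action of the Weyl algebra on formal series by termwise differentiation. -/
def action (n : ℕ) : Weyl n →ₐ[ℂ] Module.End ℂ (Series n) :=
  RingQuot.liftAlgHom ℂ ⟨freeAction n, fun _ _ h => freeAction_rel h⟩

/-- The differential annihilator of a series, as a left ideal. -/
def annihilator (f : Series n) : Ideal (Weyl n) where
  carrier := {P | action n P f = 0}
  add_mem' {P Q} hP hQ := by
    simp only [Set.mem_ofPred_eq] at hP hQ ⊢
    simp [hP, hQ]
  zero_mem' := by simp
  smul_mem' Q P hP := by
    simp only [Set.mem_ofPred_eq] at hP ⊢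
    simp [hP]

/-- `f` is a solution of the system of differential equations `I`. -/
def IsSolution (I : Ideal (Weyl n)) (f : Series n) : Prop :=
  ∀ P ∈ I, action n P f = 0

/-- The Zariski closure of a subset of `ℂ^n`. -/
def zariskiClosure (S : Set (Fin n → ℂ)) : Set (Fin n → ℂ) :=
  MvPolynomial.zeroLocus ℂ (MvPolynomial.vanishingIdeal ℂ S)

/-- The translate `v + L` of a lattice `L ⊆ ℤ^n` by `v ∈ ℂ^n`. -/
def translate (v : Fin n → ℂ) (L : AddSubgroup (Fin n → ℤ)) : Set (Fin n → ℂ) :=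
  {w | ∃ u ∈ L, w = fun j => v j + (u j : ℂ)}

/-- `f` is fully supported: it has the form `x^v ∑_{u ∈ L} λ_u x^u` for some lattice `L ⊆ ℤ^n`
and some `v ∈ ℂ^n`, and its support is Zariski dense in the Zariski closure of `v + L`. -/
def FullySupported (f : Series n) : Prop :=
  ∃ (v : Fin n → ℂ) (L : AddSubgroup (Fin n → ℤ)),
    Function.support f ⊆ translate v L ∧
      zariskiClosure (Function.support f) = zariskiClosure (translate v L)

end AHyp

end

noncomputable section

namespace AHyp

variable {n d : ℕ}

/-! ### Farkas' lemma over an ordered field -/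

/-! Grade `D` by `A`-degree: `x^μ ∂^ν` has degree `α = Aν - Aμ`. The Euler operators confine the
support of `f` to `{z | A z = β}`, so a homogeneous `P` of degree `α` sends `f` to a series
supported on `A z = β - α`. Distinct degrees give disjoint supports, hence each homogeneous
component of an annihilating operator annihilates `f` separately.

For `P` homogeneous, induct on its degree in `x`. The commutator of `P` with a toric binomial has
smaller `x`-degree and still kills `f`, so it lies in `H_A(β)`; it follows that `H_A(β - α) P ⊆
H_A(β)`. For large `w`, `∂^w P` is congruent to some `q(θ) ∂^u` modulo `H_A(β)`. Here `q(θ)` kills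
`g = ∂^u f`, a nonzero solution with parameter `β - Au`, so `q` vanishes on the support of `g`. That
support is Zariski dense in the affine fiber `A z = β - Au`; thus `q` lies in the ideal of the Euler
polynomials and `∂^w P ∈ H_A(β)`. Finally `∂^w` has a left inverse `Q` modulo `H_A(β - α)`, and `P =
Q ∂^w P - (Q ∂^w - 1) P` lies in `H_A(β)`.

Nonresonance supplies both the inverse and the density through `exists_positive_relation`: on the
fiber there are `c, e ∈ ℕ^n` with `Ac = Ae`, `e` strictly positive, and `c` supported on the
nonintegral coordinates, where `x^c ∂^c` acts by a nonzero scalar. Since density in the fiber is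
thereby automatic, full support enters only through `f ≠ 0`. -/

/-- **Farkas' lemma** for finitely many vectors of a vector space over an ordered field. -/
theorem farkas {K V ι : Type*} [Field K] [LinearOrder K] [IsStrictOrderedRing K]
    [AddCommGroup V] [Module K V] (s : Finset ι) (a : ι → V) (b : V) :
    (∃ c : ι → K, (∀ i, 0 ≤ c i) ∧ b = ∑ i ∈ s, c i • a i) ∨
      ∃ f : V →ₗ[K] K, (∀ i ∈ s, 0 ≤ f (a i)) ∧ f b < 0 := by
  classical
  induction s using Finset.induction_on generalizing a b with
  | empty =>
    by_cases hb : b = 0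
    · exact Or.inl ⟨0, by simp, by simp [hb]⟩
    · have hne : ∃ f : Module.Dual K V, f b ≠ 0 := by
        by_contra! h
        exact hb ((Module.forall_dual_apply_eq_zero_iff K b).1 h)
      obtain ⟨f, hf⟩ := hne
      rcases lt_or_gt_of_ne hf with h | h
      · exact Or.inr ⟨f, by simp, h⟩
      · exact Or.inr ⟨-f, by simp, by simpa using h⟩
  | insert k s hk ih =>
    rcases ih a b with ⟨c, hc, hb⟩ | ⟨f, hf, hfb⟩
    · refine Or.inl ⟨Function.update c k 0, fun i => ?_, ?_⟩
      · by_cases hi : i = k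
        · simp [hi]
        · simp [hi, hc]
      · rw [Finset.sum_insert hk, hb]
        simp only [Function.update_self, zero_smul, zero_add]
        refine Finset.sum_congr rfl fun i hi => ?_
        rw [Function.update_of_ne (ne_of_mem_of_not_mem hi hk)]
    by_cases hfk : 0 ≤ f (a k)
    · exact Or.inr ⟨f, fun i hi => (Finset.mem_insert.1 hi).elim (fun h => h ▸ hfk) (hf i), hfb⟩
    push Not at hfk
    -- The projection onto `ker f` along `a k`; it kills `a k`, so the induction hypothesis applies
    -- to the projected vectors.
    let p : V →ₗ[K] V := LinearMap.id - (f.smulRight ((f (a k))⁻¹ • a k))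
    have hp (v : V) : p v = v - (f v * (f (a k))⁻¹) • a k := by simp [p, smul_smul]
    rcases ih (fun i => p (a i)) (p b) with ⟨c, hc, hb⟩ | ⟨g, hg, hgb⟩
    -- The coefficient of `a k` is what lifting the projected relation back to `V` forces; it is
    -- nonnegative since `f b < 0`, `f (a k) < 0` and `f (a i) ≥ 0`.
    · refine Or.inl ⟨Function.update c k
        (f b * (f (a k))⁻¹ - ∑ i ∈ s, c i * (f (a i) * (f (a k))⁻¹)), fun i => ?_, ?_⟩
      · by_cases hi : i = k
        · subst hi
          simp only [Function.update_self, sub_nonneg]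
          refine (Finset.sum_nonpos fun j hj => ?_).trans
            (mul_nonneg_of_nonpos_of_nonpos hfb.le (inv_nonpos.2 hfk.le))
          exact mul_nonpos_of_nonneg_of_nonpos (hc j)
            (mul_nonpos_of_nonneg_of_nonpos (hf j hj) (inv_nonpos.2 hfk.le))
        · simp [hi, hc]
      · rw [Finset.sum_insert hk, Function.update_self]
        have h1 : ∑ i ∈ s, Function.update c k
            (f b * (f (a k))⁻¹ - ∑ i ∈ s, c i * (f (a i) * (f (a k))⁻¹)) i • a i =
              ∑ i ∈ s, c i • a i := Finset.sum_congr rfl fun i hi => by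
          rw [Function.update_of_ne (ne_of_mem_of_not_mem hi hk)]
        have h2 : ∑ i ∈ s, c i • p (a i) =
            ∑ i ∈ s, c i • a i - (∑ i ∈ s, c i * (f (a i) * (f (a k))⁻¹)) • a k := by
          simp only [hp, smul_sub, Finset.sum_sub_distrib, smul_smul, Finset.sum_smul]
        rw [h2, hp, sub_eq_iff_eq_add] at hb
        rw [h1, sub_smul]
        refine hb.trans ?_
        abel
    · refine Or.inr ⟨g.comp p, fun i hi => ?_, hgb⟩
      rcases Finset.mem_insert.1 hi with rfl | hi
      · simp [hp, mul_inv_cancel₀ hfk.ne]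
      · exact hg i hi

/-- Clearing denominators in a finite family of rational numbers. -/
theorem exists_common_denominator {ι : Type*} [Fintype ι] (q : ι → ℚ) :
    ∃ N : ℕ, 0 < N ∧ ∃ m : ι → ℤ, ∀ i, (N : ℚ) * q i = m i := by
  classical
  refine ⟨∏ i, (q i).den, Finset.prod_pos fun i _ => (q i).pos,
    fun i => (∏ j ∈ Finset.univ.erase i, (q j).den : ℕ) * (q i).num, fun i => ?_⟩
  rw [← Finset.mul_prod_erase _ _ (Finset.mem_univ i)]
  push_cast
  rw [mul_right_comm, mul_comm ((q i).den : ℚ), Rat.mul_den_eq_num, mul_comm]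

/-! ### Facets and nonresonance -/

/-- The degree `A u` of an exponent vector `u ∈ ℕ^n`. -/
def deg (A : Matrix (Fin d) (Fin n) ℤ) (u : Fin n → ℕ) : Fin d → ℤ :=
  A.mulVec fun j => (u j : ℤ)

theorem deg_add (A : Matrix (Fin d) (Fin n) ℤ) (u v : Fin n → ℕ) :
    deg A (u + v) = deg A u + deg A v := by
  simp only [deg, ← Matrix.mulVec_add]
  congr 1

@[simp]
theorem deg_zero (A : Matrix (Fin d) (Fin n) ℤ) : deg A 0 = 0 := by
  funext i
  simp [deg, Matrix.mulVec, dotProduct]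

theorem deg_nsmul (A : Matrix (Fin d) (Fin n) ℤ) (k : ℕ) (u : Fin n → ℕ) :
    deg A (k • u) = k • deg A u := by
  simp only [deg, ← Matrix.mulVec_smul]
  congr 1

/-- The map `A : ℂ^n → ℂ^d`. -/
def weight (A : Matrix (Fin d) (Fin n) ℤ) (z : Fin n → ℂ) (i : Fin d) : ℂ :=
  ∑ j, (A i j : ℂ) * z j

theorem exists_mulVec_eq {A : Matrix (Fin d) (Fin n) ℤ}
    (hspan : Submodule.span ℤ (Set.range A.transpose) = ⊤) (y : Fin d → ℤ) :
    ∃ u : Fin n → ℤ, A.mulVec u = y := by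
  have h : y ∈ Submodule.span ℤ (Set.range A.col) := hspan ▸ Submodule.mem_top
  rw [← Matrix.range_mulVecLin] at h
  exact h

theorem colVal_eq_sum_mul (A : Matrix (Fin d) (Fin n) ℤ) (h : Fin d → ℤ) (u : Fin n → ℤ) :
    ∑ i, h i * A.mulVec u i = ∑ j, colVal A h j * u j := by
  simp only [Matrix.mulVec, dotProduct, colVal, Finset.mul_sum, Finset.sum_mul]
  rw [Finset.sum_comm]
  simp only [mul_assoc]

/-- A functional cutting out a face has a primitive multiple. -/
theorem exists_primitiveSupport {A : Matrix (Fin d) (Fin n) ℤ}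
    (hspan : Submodule.span ℤ (Set.range A.transpose) = ⊤) {σ : Set (Fin n)} (hσ : IsFace A σ) :
    ∃ ν : Fin d → ℚ, IsPrimitiveSupport A σ ν := by
  classical
  obtain ⟨h, h0, hpos, rfl⟩ := hσ
  -- Values of `h` on `ℤA = ℤ^d` form an ideal `(g)`, nonzero because `h ≠ 0`; dividing `h` by `g`
  -- makes it primitive.
  let I : Ideal ℤ := Ideal.span (Set.range (colVal A h))
  have hI (x : ℤ) : x ∈ I ↔ ∃ u : Fin n → ℤ, ∑ i, h i * A.mulVec u i = x := by
    simp only [I, Ideal.span, Submodule.mem_span_range_iff_exists_fun, colVal_eq_sum_mul,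
      smul_eq_mul, mul_comm]
  obtain ⟨g, hg0, hg⟩ : ∃ g : ℕ, g ≠ 0 ∧ I = Ideal.span {(g : ℤ)} := by
    obtain ⟨g, hg⟩ := (IsPrincipalIdealRing.principal I).principal
    refine ⟨g.natAbs, fun h1 => h0 ?_, by rw [Int.span_natAbs]; exact hg⟩
    funext i
    obtain ⟨u, hu⟩ := exists_mulVec_eq hspan (Pi.single i 1)
    have h2 : h i ∈ I := (hI _).2 ⟨u, by simp [hu, Pi.single_apply]⟩
    rw [Int.natAbs_eq_zero] at h1
    rw [hg, h1] at h2
    simpa using h2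
  have hgQ : (g : ℚ) ≠ 0 := Nat.cast_ne_zero.2 hg0
  have hval (j : Fin n) : ∑ i, (h i / g : ℚ) * (A i j : ℚ) = (colVal A h j : ℚ) / g := by
    simp only [colVal, Int.cast_sum, Int.cast_mul, Finset.sum_div]
    exact Finset.sum_congr rfl fun i _ => by ring
  refine ⟨fun i => h i / g, ?_, fun j => ?_, fun j hj => ?_⟩
  · ext x
    have key (u : Fin n → ℤ) : ∑ i, (h i / g : ℚ) * ((A.mulVec u i : ℤ) : ℚ) =
        ((∑ i, h i * A.mulVec u i : ℤ) : ℚ) / g := by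
      push_cast
      rw [Finset.sum_div]
      exact Finset.sum_congr rfl fun i _ => by ring
    simp only [Set.mem_range, key]
    constructor
    · rintro ⟨u, rfl⟩
      have h1 : ∑ i, h i * A.mulVec u i ∈ I := (hI _).2 ⟨u, rfl⟩
      rw [hg, Ideal.mem_span_singleton'] at h1
      obtain ⟨k, hk⟩ := h1
      refine ⟨k, ?_⟩
      rw [← hk]
      push_cast
      field_simp
    · rintro ⟨k, rfl⟩
      have h1 : k * (g : ℤ) ∈ I := hg ▸ Ideal.mem_span_singleton'.2 ⟨k, rfl⟩
      obtain ⟨u, hu⟩ := (hI _).1 h1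
      refine ⟨u, ?_⟩
      rw [hu]
      push_cast
      field_simp
  · rw [hval]
    exact div_nonneg (Int.cast_nonneg (hpos j)) (Nat.cast_nonneg g)
  · rw [hval, show colVal A h j = 0 from hj]
    simp

/-- No face contains all columns at which a solution of `A z = β` is not integral, if `β` is
nonresonant. -/
theorem not_isFace_of_nonresonant {A : Matrix (Fin d) (Fin n) ℤ}
    (hspan : Submodule.span ℤ (Set.range A.transpose) = ⊤) {β : Fin d → ℂ}
    (hβ : Nonresonant A β) {z : Fin n → ℂ} (hz : weight A z = β) {τ : Set (Fin n)}
    (hτ : IsFace A τ) (hzτ : ∀ k, (∀ m : ℤ, z k ≠ m) → k ∈ τ) : False := by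
  classical
  obtain ⟨σ, hτσ, hσ⟩ := (Set.toFinite {σ | IsFace A σ}).exists_le_maximal hτ
  obtain ⟨ν, hν⟩ := exists_primitiveSupport hspan hσ.prop
  -- Every term of `ν(β) = ∑ ν(a_j) z_j` is an integer: on the facet `ν(a_j) = 0`, and off it both
  -- `ν(a_j)` and `z_j` are integers. This contradicts nonresonance.
  have hint (j : Fin n) : ∃ m : ℤ, ((∑ i, ν i * (A i j : ℚ) : ℚ) : ℂ) * z j = m := by
    by_cases hj : j ∈ σ
    · exact ⟨0, by rw [hν.eq_zero j hj]; simp⟩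
    · obtain ⟨m, hm⟩ : ∃ m : ℤ, z j = m := by
        by_contra! h
        exact hj (hτσ (hzτ j h))
      have h1 : ∑ i, ν i * ((A.mulVec (Pi.single j 1) i : ℤ) : ℚ) ∈
          Set.range (fun k : ℤ => (k : ℚ)) := hν.image_eq ▸ Set.mem_range_self _
      obtain ⟨k, hk⟩ := h1
      refine ⟨k * m, ?_⟩
      simp only [Matrix.mulVec_single_one, Matrix.col_apply] at hk
      rw [← hk, hm]
      push_cast
      rfl
  choose m hm using hint
  refine hβ σ hσ ν hν (∑ j, m j) ?_
  push_cast
  simp only [← hm, ← hz, weight, Finset.mul_sum]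
  rw [Finset.sum_comm]
  push_cast
  simp only [Finset.sum_mul, mul_assoc]

/-- If `A z = β` with `β` nonresonant, then the columns at which `z` is not integral meet the
relative interior of the cone: some nonnegative combination of them is a strictly positive
combination of all columns. -/
theorem exists_positive_relation {A : Matrix (Fin d) (Fin n) ℤ}
    (hspan : Submodule.span ℤ (Set.range A.transpose) = ⊤) {β : Fin d → ℂ}
    (hβ : Nonresonant A β) {z : Fin n → ℂ} (hz : weight A z = β) :
    ∃ c e : Fin n → ℕ, (∀ k, c k ≠ 0 → ∀ m : ℤ, z k ≠ m) ∧ (∀ k, 0 < e k) ∧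
      deg A c = deg A e := by
  classical
  let col : Fin n → Fin d → ℚ := fun k i => A i k
  -- The columns together with the negatives of the nonintegral ones. If their cone missed some
  -- `-a_k`, Farkas would give a functional nonnegative on all columns, zero on the nonintegral ones
  -- and positive on `a_k`: a face that nonresonance excludes.
  let a : Fin n ⊕ Fin n → Fin d → ℚ :=
    Sum.elim col fun k => if ∀ m : ℤ, z k ≠ m then -col k else 0
  have hcone (k : Fin n) : ∃ q : Fin n ⊕ Fin n → ℚ, (∀ i, 0 ≤ q i) ∧
      -col k = ∑ i, q i • a i := by
    refine (farkas Finset.univ a (-col k)).resolve_right ?_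
    rintro ⟨f, hf, hfk⟩
    obtain ⟨N, hN, h, hh⟩ := exists_common_denominator fun i => f (Pi.single i 1)
    have hNQ : (0 : ℚ) < N := Nat.cast_pos.2 hN
    have hcol (j : Fin n) : ((colVal A h j : ℤ) : ℚ) = N * f (col j) := by
      rw [f.pi_apply_eq_sum_univ, colVal, Finset.mul_sum]
      push_cast
      refine Finset.sum_congr rfl fun i _ => ?_
      have h1 : (fun j => if i = j then (1 : ℚ) else 0) = Pi.single i 1 := by
        funext j
        simp [Pi.single_apply, eq_comm]
      rw [h1, ← hh, smul_eq_mul]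
      simp only [col]
      ring
    have hpos (j : Fin n) : 0 ≤ colVal A h j := by
      have h1 := mul_nonneg hNQ.le (hf (Sum.inl j) (Finset.mem_univ _))
      rw [← Int.cast_nonneg_iff (R := ℚ), hcol]
      exact h1
    have hk : colVal A h k ≠ 0 := fun h0 => by
      have h1 := hcol k
      rw [map_neg] at hfk
      rw [h0, Int.cast_zero] at h1
      nlinarith
    refine not_isFace_of_nonresonant hspan hβ hz
      ⟨h, fun h0 => hk (by simp [h0, colVal]), hpos, rfl⟩ fun j hj => ?_
    have h1 := mul_nonneg hNQ.le (hf (Sum.inr j) (Finset.mem_univ _))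
    simp only [a, Sum.elim_inr, if_pos hj, map_neg, mul_neg, ← hcol] at h1
    refine le_antisymm ?_ (hpos j)
    rw [neg_nonneg] at h1
    exact_mod_cast h1
  choose q hq hqk using hcone
  obtain ⟨N, hN, m, hm⟩ := exists_common_denominator fun i => ∑ k, q k i
  have hm0 (i) : 0 ≤ m i := by
    have h1 : (0 : ℚ) ≤ N * ∑ k, q k i :=
      mul_nonneg (Nat.cast_nonneg N) (Finset.sum_nonneg fun k _ => hq k i)
    rw [hm] at h1
    exact_mod_cast h1
  -- Sum the relations for all `-a_k`, clear denominators by `N`, and move negative terms across.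
  -- The summand `N` coming from `-∑ a_k` makes `e` strictly positive.
  refine ⟨fun k => if ∀ m : ℤ, z k ≠ m then (m (Sum.inr k)).toNat else 0,
    fun k => (m (Sum.inl k)).toNat + N, fun k hk => ?_, fun k => by lia, ?_⟩
  · by_contra h
    exact hk (if_neg h)
  · have hsum : -∑ k, col k = ∑ i, (∑ k, q k i) • a i := by
      simp only [← Finset.sum_neg_distrib, Finset.sum_smul]
      rw [Finset.sum_comm]
      exact Finset.sum_congr rfl fun k _ => hqk k
    have hN' := congrArg (fun v => (N : ℚ) • v) hsum
    simp only [Finset.smul_sum, smul_smul, hm, Fintype.sum_sum_type, a, Sum.elim_inl,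
      Sum.elim_inr, smul_neg, smul_add] at hN'
    funext i
    have hi := congrFun hN' i
    simp only [Pi.neg_apply, Finset.sum_apply, Pi.smul_apply, Pi.add_apply, smul_eq_mul] at hi
    have hQ : ((deg A (fun k => if ∀ m : ℤ, z k ≠ m then (m (Sum.inr k)).toNat else 0) i : ℤ) : ℚ)
        = (deg A (fun k => (m (Sum.inl k)).toNat + N) i : ℤ) := by
      simp only [deg, Matrix.mulVec, dotProduct]
      push_cast
      rw [← sub_eq_zero, ← Finset.sum_sub_distrib]
      rw [← sub_eq_zero, ← Finset.sum_neg_distrib, ← Finset.sum_add_distrib,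
        ← Finset.sum_sub_distrib] at hi
      refine (Finset.sum_congr rfl fun k _ => ?_).trans hi
      have h1 : (((m (Sum.inl k)).toNat : ℕ) : ℚ) = m (Sum.inl k) := by
        exact_mod_cast Int.toNat_of_nonneg (hm0 _)
      have h2 : (((m (Sum.inr k)).toNat : ℕ) : ℚ) = m (Sum.inr k) := by
        exact_mod_cast Int.toNat_of_nonneg (hm0 _)
      by_cases hk : ∀ m : ℤ, z k ≠ m
      · simp only [if_pos hk, h1, h2, col, Pi.neg_apply]
        ring
      · simp only [if_neg hk, h1, h2, col, Pi.zero_apply]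
        ring
    exact_mod_cast hQ

/-! ### Ordered monomials in commuting elements -/

section Monomials

/-- The ordered monomial `c_1^{u_1} ⋯ c_n^{u_n}`. -/
def monom {R : Type*} [Ring R] (c : Fin n → R) (u : Fin n → ℕ) : R :=
  (List.ofFn fun j => c j ^ u j).prod

@[simp]
theorem monom_zero {R : Type*} [Ring R] (c : Fin n → R) : monom c 0 = 1 := by
  simp [monom]

variable {R : Type*} [Ring R] [Algebra ℂ R]

open scoped IsMulCommutative in
/-- The evaluation of polynomials at a family of commuting elements. -/
def commEval (c : Fin n → R) (hc : ∀ i j, c i * c j = c j * c i) :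
    MvPolynomial (Fin n) ℂ →ₐ[ℂ] R :=
  haveI : IsMulCommutative (Algebra.adjoin ℂ (Set.range c)) :=
    Algebra.isMulCommutative_adjoin ℂ (by
      rintro _ ⟨i, rfl⟩ _ ⟨j, rfl⟩
      exact hc i j)
  (Algebra.adjoin ℂ (Set.range c)).val.comp
    (MvPolynomial.aeval (S₁ := Algebra.adjoin ℂ (Set.range c)) fun i : Fin n =>
      (⟨c i, Algebra.subset_adjoin ⟨i, rfl⟩⟩ : Algebra.adjoin ℂ (Set.range c)))

@[simp]
theorem commEval_X (c : Fin n → R) (hc) (i : Fin n) :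
    commEval c hc (MvPolynomial.X i) = c i := by
  simp [commEval]

theorem commEval_prod (c : Fin n → R) (hc) (u : Fin n → ℕ) :
    commEval c hc (∏ j, MvPolynomial.X j ^ u j) = monom c u := by
  rw [← List.prod_ofFn, map_list_prod, List.map_ofFn, monom]
  congr 2
  funext j
  simp

theorem monom_add {c : Fin n → R} (hc : ∀ i j, c i * c j = c j * c i) (u v : Fin n → ℕ) :
    monom c (u + v) = monom c u * monom c v := by
  rw [← commEval_prod c hc, ← commEval_prod c hc, ← commEval_prod c hc, ← map_mul,
    ← Finset.prod_mul_distrib]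
  simp only [Pi.add_apply, pow_add]

theorem monom_single {c : Fin n → R} (hc : ∀ i j, c i * c j = c j * c i) (i : Fin n) :
    monom c (Pi.single i 1) = c i := by
  rw [← commEval_prod c hc, Finset.prod_eq_single i]
  · simp
  · intro j _ hj
    simp [hj]
  · simp

end Monomials

/-- Induction on exponent vectors. -/
theorem exponent_induction {p : (Fin n → ℕ) → Prop} (h0 : p 0)
    (hs : ∀ u i, p u → p (u + Pi.single i 1)) (u : Fin n → ℕ) : p u := by
  induction hk : ∑ i, u i generalizing u with
  | zero =>
    have : u = 0 := by
      funext i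
      simpa using Finset.sum_eq_zero_iff.1 hk i (Finset.mem_univ i)
    exact this ▸ h0
  | succ k ih =>
    obtain ⟨i, -, hi⟩ := Finset.exists_ne_zero_of_sum_ne_zero (hk.trans_ne k.succ_ne_zero)
    have hu : (u - Pi.single i 1) + Pi.single i 1 = u := by
      funext j
      by_cases hj : j = i
      · subst hj
        simp
        lia
      · simp [hj]
    rw [← hu]
    refine hs _ i (ih _ ?_)
    have h1 := congrArg (fun v => ∑ j, v j) hu
    simp only [Pi.add_apply, Finset.sum_add_distrib, Finset.sum_pi_single', Finset.mem_univ,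
      if_true, hk] at h1
    lia

/-! ### Commutation relations in the Weyl algebra -/

theorem X_mul_X (i j : Fin n) : (X i : Weyl n) * X j = X j * X i := by
  simp only [X, ← map_mul]
  exact RingQuot.mkAlgHom_rel ℂ (WeylRel.xx i j)

theorem del_mul_del (i j : Fin n) : (del i : Weyl n) * del j = del j * del i := by
  simp only [del, ← map_mul]
  exact RingQuot.mkAlgHom_rel ℂ (WeylRel.dd i j)

theorem del_mul_X (i j : Fin n) :
    (del i : Weyl n) * X j = X j * del i + if i = j then 1 else 0 := by
  have h := RingQuot.mkAlgHom_rel ℂ (WeylRel.dx i j)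
  simp only [map_add, map_mul] at h
  rw [del, X, h]
  split_ifs
  · rw [map_one]
  · rw [map_zero]

/-- The monomial `x^u`. -/
abbrev xPow (u : Fin n → ℕ) : Weyl n := monom X u

@[simp]
theorem delPow_zero : delPow (0 : Fin n → ℕ) = 1 := monom_zero _

theorem xPow_add (u v : Fin n → ℕ) : xPow (u + v) = xPow u * xPow v := monom_add X_mul_X u v

theorem delPow_add (u v : Fin n → ℕ) : delPow (u + v) = delPow u * delPow v :=
  monom_add del_mul_del u v

@[simp]
theorem xPow_single (i : Fin n) : xPow (Pi.single i 1) = X i := monom_single X_mul_X i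

@[simp]
theorem delPow_single (i : Fin n) : delPow (Pi.single i 1) = del i := monom_single del_mul_del i

/-- Truncated subtraction is harmless: when `μ i = 0` the coefficient vanishes. -/
theorem del_mul_xPow (i : Fin n) (μ : Fin n → ℕ) :
    del i * xPow μ = xPow μ * del i + (μ i : ℂ) • xPow (μ - Pi.single i 1) := by
  induction μ using exponent_induction with
  | h0 => simp
  | hs μ l ih =>
    rw [xPow_add, xPow_single, ← mul_assoc, ih, add_mul, mul_assoc, del_mul_X, mul_add, add_assoc,
      mul_assoc]
    congr 1
    by_cases hl : i = l
    · subst hl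
      rw [add_tsub_cancel_right]
      by_cases h0 : μ i = 0
      · simp [h0]
      · have hμ : xPow μ = xPow (μ - Pi.single i 1) * X i := by
          rw [← xPow_single, ← xPow_add]
          congr 1
          funext j
          by_cases hj : j = i
          · subst hj
            simp
            lia
          · simp [hj]
        simp [hμ, add_smul, add_comm]
    · have h1 : μ + Pi.single l 1 - Pi.single i 1 = (μ - Pi.single i 1) + Pi.single l 1 := by
        funext j
        by_cases hj : j = i
        · subst hj
          simp [hl]
        · simp [hj]
      rw [h1, xPow_add, xPow_single]
      simp [hl]

theorem theta_mul_X (j i : Fin n) :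
    (theta j : Weyl n) * X i = X i * theta j + if j = i then X i else 0 := by
  rw [theta, mul_assoc, del_mul_X, mul_add, ← mul_assoc, X_mul_X, mul_assoc]
  split_ifs with h
  · simp [h]
  · simp

theorem del_mul_theta (i j : Fin n) :
    (del i : Weyl n) * theta j = theta j * del i + if i = j then del i else 0 := by
  rw [theta, ← mul_assoc, del_mul_X, add_mul, mul_assoc, del_mul_del, mul_assoc]
  split_ifs with h
  · simp [h]
  · simp

theorem theta_mul_theta (i j : Fin n) : (theta i : Weyl n) * theta j = theta j * theta i := by
  by_cases h : i = j
  · rw [h]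
  · have h1 := theta_mul_X i j
    have h2 := del_mul_theta j i
    rw [if_neg h, add_zero] at h1
    rw [if_neg (Ne.symm h), add_zero] at h2
    calc theta i * theta j = X j * theta i * del j := by rw [theta.eq_def j, ← mul_assoc, h1]
      _ = theta j * theta i := by rw [mul_assoc, ← h2, ← mul_assoc]; rfl

theorem theta_mul_xPow (j : Fin n) (μ : Fin n → ℕ) :
    theta j * xPow μ = xPow μ * theta j + (μ j : ℂ) • xPow μ := by
  induction μ using exponent_induction with
  | h0 => simp
  | hs μ l ih =>
    rw [xPow_add, xPow_single, ← mul_assoc, ih, add_mul, mul_assoc, theta_mul_X, mul_add,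
      mul_assoc]
    by_cases h : j = l
    · subst h
      simp only [if_true, Pi.add_apply, Pi.single_eq_same, Nat.cast_add, Nat.cast_one, add_smul,
        one_smul, smul_mul_assoc]
      abel
    · simp [h]

theorem theta_mul_delPow (j : Fin n) (ν : Fin n → ℕ) :
    theta j * delPow ν = delPow ν * theta j - (ν j : ℂ) • delPow ν := by
  induction ν using exponent_induction with
  | h0 => simp
  | hs ν l ih =>
    have h1 := del_mul_theta l j
    rw [eq_comm, ← eq_sub_iff_add_eq] at h1
    rw [delPow_add, delPow_single, ← mul_assoc, ih, sub_mul, mul_assoc, h1, mul_sub, mul_assoc]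
    by_cases h : l = j
    · subst h
      simp [add_smul, sub_sub, add_comm]
    · simp [h, Ne.symm h]

/-! ### Polynomials in the `θ_j` -/

/-- The polynomial `q(θ_1, …, θ_n)` in the Weyl algebra. -/
def thetaEval : MvPolynomial (Fin n) ℂ →ₐ[ℂ] Weyl n := commEval theta theta_mul_theta

@[simp]
theorem thetaEval_X (j : Fin n) : thetaEval (MvPolynomial.X j) = theta j := commEval_X ..

/-- `∂^u` normalizes the polynomials in `θ`. -/
theorem exists_delPow_mul_thetaEval (u : Fin n → ℕ) (p : MvPolynomial (Fin n) ℂ) :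
    ∃ q, delPow u * thetaEval p = thetaEval q * delPow u := by
  induction p using MvPolynomial.induction_on with
  | C a => exact ⟨MvPolynomial.C a, by
      simp only [MvPolynomial.C_eq_algebraMap, AlgHom.commutes, Algebra.commutes]⟩
  | add p q hp hq =>
    obtain ⟨p', hp⟩ := hp
    obtain ⟨q', hq⟩ := hq
    exact ⟨p' + q', by rw [map_add, mul_add, hp, hq, map_add, add_mul]⟩
  | mul_X p j hp =>
    obtain ⟨p', hp⟩ := hp
    refine ⟨p' * (MvPolynomial.X j + MvPolynomial.C (u j : ℂ)), ?_⟩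
    have h1 := theta_mul_delPow j u
    rw [eq_sub_iff_add_eq] at h1
    rw [map_mul, thetaEval_X, ← mul_assoc, hp, mul_assoc, ← h1, map_mul, mul_assoc, map_add,
      thetaEval_X, add_mul, MvPolynomial.C_eq_algebraMap, AlgHom.commutes, ← Algebra.smul_def]

/-- `x^u ∂^u` is the product of the falling factorials `θ_k (θ_k - 1) ⋯ (θ_k - u_k + 1)`, whose
zeros have an integral coordinate `z_k` with `u_k ≠ 0`. -/
theorem exists_xPow_mul_delPow_eq (u : Fin n → ℕ) : ∃ p : MvPolynomial (Fin n) ℂ,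
    xPow u * delPow u = thetaEval p ∧
      ∀ z : Fin n → ℂ, (∀ k, u k ≠ 0 → ∀ m : ℤ, z k ≠ m) → MvPolynomial.eval z p ≠ 0 := by
  induction u using exponent_induction with
  | h0 => exact ⟨1, by simp, by simp⟩
  | hs u i ih =>
    obtain ⟨p, hp, hpz⟩ := ih
    refine ⟨(MvPolynomial.X i - MvPolynomial.C (u i : ℂ)) * p, ?_, fun z hz => ?_⟩
    · have h1 := theta_mul_xPow i u
      rw [← sub_eq_iff_eq_add] at h1
      rw [add_comm u, delPow_add, delPow_single, add_comm _ u, xPow_add, xPow_single, mul_assoc,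
        ← mul_assoc (X i), ← theta, ← mul_assoc, ← h1, sub_mul, mul_assoc, hp, smul_mul_assoc, hp,
        map_mul, map_sub, thetaEval_X, sub_mul, MvPolynomial.C_eq_algebraMap, AlgHom.commutes,
        ← Algebra.smul_def]
    · rw [map_mul]
      refine mul_ne_zero ?_ (hpz z fun k hk => hz k (by simp [hk]))
      have := hz i (by simp) (u i)
      simpa [sub_eq_zero] using this

/-- `∂^w x^μ` is a left multiple of `∂^(w-μ)` by a polynomial in `θ`. -/
theorem exists_delPow_mul_xPow (v μ : Fin n → ℕ) :
    ∃ q, delPow (v + μ) * xPow μ = thetaEval q * delPow v := by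
  induction μ using exponent_induction generalizing v with
  | h0 => exact ⟨1, by simp⟩
  | hs μ i ih =>
    obtain ⟨q, hq⟩ := ih (v + Pi.single i 1)
    obtain ⟨r, hr⟩ := exists_delPow_mul_thetaEval v (MvPolynomial.X i + 1)
    refine ⟨q * r, ?_⟩
    have h1 : thetaEval (MvPolynomial.X i + 1) = del i * X i := by
      rw [del_mul_X, if_pos rfl, map_add, map_one, thetaEval_X, theta]
    rw [add_comm μ, ← add_assoc, add_comm (Pi.single i 1), xPow_add, ← mul_assoc, hq, mul_assoc,
      delPow_add, delPow_single, xPow_single, mul_assoc, ← h1, hr, map_mul, mul_assoc]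

/-! ### The action on series -/

@[simp]
theorem action_X (i : Fin n) : action n (X i) = mulX i := by
  simp [action, X, freeAction]

@[simp]
theorem action_del (i : Fin n) : action n (del i) = diff i := by
  simp [action, del, freeAction]

theorem action_theta (j : Fin n) (g : Series n) (w : Fin n → ℂ) :
    action n (theta j) g w = w j * g w := by
  simp [theta, mulX, diff]

theorem action_thetaEval (p : MvPolynomial (Fin n) ℂ) (g : Series n) (w : Fin n → ℂ) :
    action n (thetaEval p) g w = MvPolynomial.eval w p * g w := by
  induction p using MvPolynomial.induction_on generalizing g with
  | C a =>
    rw [MvPolynomial.eval_C, MvPolynomial.C_eq_algebraMap, AlgHom.commutes, AlgHom.commutes,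
      Module.algebraMap_end_apply]
    rfl
  | add p q hp hq => simp [hp, hq, add_mul]
  | mul_X p j hp => simp [hp, action_theta, mul_assoc]

theorem action_xPow (μ : Fin n → ℕ) (g : Series n) (w : Fin n → ℂ) :
    action n (xPow μ) g w = g fun j => w j - μ j := by
  induction μ using exponent_induction generalizing w with
  | h0 => simp
  | hs μ i ih =>
    rw [add_comm, xPow_add, xPow_single, map_mul, Module.End.mul_apply, action_X]
    refine (ih (w - Pi.single i 1)).trans ?_
    congr 1
    funext j
    by_cases hj : j = i
    · subst hj
      simp [sub_sub]
    · simp [hj]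

/-- Only the location of the coefficient matters later, so the scalar is left unspecified. -/
theorem action_delPow (ν : Fin n → ℕ) (g : Series n) (w : Fin n → ℂ) :
    ∃ s : ℂ, action n (delPow ν) g w = s * g fun j => w j + ν j := by
  induction ν using exponent_induction generalizing g with
  | h0 => exact ⟨1, by simp⟩
  | hs ν i ih =>
    obtain ⟨s, hs⟩ := ih (diff i g)
    refine ⟨s * (w i + ν i + 1), ?_⟩
    rw [delPow_add, delPow_single, map_mul, Module.End.mul_apply, action_del, hs, mul_assoc]
    congr 1
    simp only [diff, LinearMap.coe_mk, AddHom.coe_mk]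
    congr 2
    funext j
    by_cases hj : j = i
    · subst hj
      simp [add_assoc]
    · simp [hj]

/-! ### Generators of the hypergeometric ideal -/

section Ideal

variable {A : Matrix (Fin d) (Fin n) ℤ} {β : Fin d → ℂ}

theorem binomial_mem {u v : Fin n → ℕ} (h : deg A u = deg A v) :
    delPow u - delPow v ∈ hypergeometricIdeal A β :=
  (le_sup_left : Ideal.span (toricBinomials A) ≤ hypergeometricIdeal A β)
    (Ideal.subset_span ⟨u, v, h, rfl⟩)

theorem euler_sub_mem (i : Fin d) :
    euler A i - algebraMap ℂ (Weyl n) (β i) ∈ hypergeometricIdeal A β :=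
  Submodule.mem_sup_right (Ideal.subset_span ⟨i, rfl⟩)

/-- If the generators of `H_A(β)` are mapped into a left ideal by right multiplication with `c`,
then so is `H_A(β)`. -/
theorem mul_mem_of_generators {I : Ideal (Weyl n)} {c : Weyl n}
    (hb : ∀ u v : Fin n → ℕ, deg A u = deg A v → (delPow u - delPow v) * c ∈ I)
    (he : ∀ i, (euler A i - algebraMap ℂ (Weyl n) (β i)) * c ∈ I) {P : Weyl n}
    (hP : P ∈ hypergeometricIdeal A β) : P * c ∈ I := by
  have h : hypergeometricIdeal A β ≤
      Submodule.comap (LinearMap.toSpanSingleton (Weyl n) (Weyl n) c) I := by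
    refine sup_le (Ideal.span_le.2 ?_) (Ideal.span_le.2 ?_)
    · rintro _ ⟨u, v, huv, rfl⟩
      exact hb u v huv
    · rintro _ ⟨i, rfl⟩
      exact he i
  exact h hP

/-- The polynomial of the Euler operator `E_i - β_i`. -/
def eulerPoly (A : Matrix (Fin d) (Fin n) ℤ) (β : Fin d → ℂ) (i : Fin d) :
    MvPolynomial (Fin n) ℂ :=
  ∑ j, (A i j : ℂ) • MvPolynomial.X j - MvPolynomial.C (β i)

theorem thetaEval_eulerPoly (i : Fin d) :
    thetaEval (eulerPoly A β i) = euler A i - algebraMap ℂ (Weyl n) (β i) := by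
  simp only [eulerPoly, euler, map_sub, map_sum, map_smul, thetaEval_X,
    MvPolynomial.C_eq_algebraMap, AlgHom.commutes]

theorem eval_eulerPoly (z : Fin n → ℂ) (i : Fin d) :
    MvPolynomial.eval z (eulerPoly A β i) = weight A z i - β i := by
  simp [eulerPoly, weight, MvPolynomial.smul_eval]

theorem action_euler (i : Fin d) (g : Series n) (w : Fin n → ℂ) :
    action n (euler A i) g w = weight A w i * g w := by
  simp only [euler, map_sum, map_smul, LinearMap.sum_apply, Finset.sum_apply, weight,
    LinearMap.smul_apply, Pi.smul_apply, action_theta, smul_eq_mul, Finset.sum_mul, mul_assoc]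

end Ideal

/-! ### The bigrading by `x`-degree and `A`-degree -/

/-- The span of the monomials `x^μ ∂^ν` of `A`-degree `α` and of degree less than `k` in `x`. -/
def homog (A : Matrix (Fin d) (Fin n) ℤ) (k : ℕ) (α : Fin d → ℤ) : Submodule ℂ (Weyl n) :=
  Submodule.span ℂ {P | ∃ μ ν : Fin n → ℕ, ∑ i, μ i < k ∧ deg A ν - deg A μ = α ∧
    P = xPow μ * delPow ν}

section Homog

variable {A : Matrix (Fin d) (Fin n) ℤ} {k : ℕ} {α : Fin d → ℤ} {P : Weyl n}

theorem xPow_mul_delPow_mem {μ ν : Fin n → ℕ} (hμ : ∑ i, μ i < k)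
    (hα : deg A ν - deg A μ = α) : xPow μ * delPow ν ∈ homog A k α :=
  Submodule.subset_span ⟨μ, ν, hμ, hα, rfl⟩

theorem delPow_mem (u : Fin n → ℕ) : delPow u ∈ homog A 1 (deg A u) := by
  have h : xPow 0 * delPow u ∈ homog A 1 (deg A u) :=
    xPow_mul_delPow_mem (by simp) (by simp)
  simpa using h

theorem homog_zero (h : P ∈ homog A 0 α) : P = 0 := by
  have : homog A 0 α = ⊥ := Submodule.span_eq_bot.2 (by rintro _ ⟨μ, ν, hμ, -⟩; simp at hμ)
  simpa [this] using h

theorem homog_mono {l : ℕ} (h : k ≤ l) : homog A k α ≤ homog A l α :=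
  Submodule.span_mono fun _ ⟨μ, ν, hμ, hα, hP⟩ => ⟨μ, ν, hμ.trans_le h, hα, hP⟩

theorem mul_mem_homog (T : Weyl n →ₗ[ℂ] Weyl n) {M : Submodule ℂ (Weyl n)}
    (h : ∀ μ ν : Fin n → ℕ, ∑ i, μ i < k → deg A ν - deg A μ = α → T (xPow μ * delPow ν) ∈ M)
    (hP : P ∈ homog A k α) : T P ∈ M := by
  have : homog A k α ≤ M.comap T := Submodule.span_le.2 (by
    rintro _ ⟨μ, ν, hμ, hα, rfl⟩
    exact h μ ν hμ hα)
  exact this hP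

theorem sum_add_single (μ : Fin n → ℕ) (i : Fin n) :
    ∑ j, (μ + Pi.single i 1 : Fin n → ℕ) j = ∑ j, μ j + 1 := by
  simp [Finset.sum_add_distrib]

theorem X_mul_mem_homog (i : Fin n) (hP : P ∈ homog A k α) :
    X i * P ∈ homog A (k + 1) (α - deg A (Pi.single i 1)) := by
  refine mul_mem_homog (LinearMap.mulLeft ℂ (X i)) (fun μ ν hμ hα => ?_) hP
  rw [LinearMap.mulLeft_apply, ← mul_assoc, ← xPow_single, ← xPow_add,
    add_comm (Pi.single i 1)]
  refine xPow_mul_delPow_mem ?_ ?_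
  · rw [sum_add_single]
    lia
  · rw [deg_add, ← hα]
    abel

theorem mul_del_mem_homog (i : Fin n) (hP : P ∈ homog A k α) :
    P * del i ∈ homog A k (α + deg A (Pi.single i 1)) := by
  refine mul_mem_homog (LinearMap.mulRight ℂ (del i)) (fun μ ν hμ hα => ?_) hP
  rw [LinearMap.mulRight_apply, mul_assoc, ← delPow_single, ← delPow_add]
  refine xPow_mul_delPow_mem hμ ?_
  rw [deg_add, ← hα]
  abel

/-- Commutation with `∂_i` lowers the degree in `x`. -/
theorem del_commutator_mem_homog (i : Fin n) (hP : P ∈ homog A (k + 1) α) :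
    del i * P - P * del i ∈ homog A k (α + deg A (Pi.single i 1)) := by
  refine mul_mem_homog (LinearMap.mulLeft ℂ (del i) - LinearMap.mulRight ℂ (del i))
    (fun μ ν hμ hα => ?_) hP
  have h1 : delPow ν * del i = del i * delPow ν := by
    rw [← delPow_single, ← delPow_add, ← delPow_add, add_comm]
  rw [LinearMap.sub_apply, LinearMap.mulLeft_apply, LinearMap.mulRight_apply, ← mul_assoc,
    del_mul_xPow, mul_assoc, h1, add_mul, mul_assoc, add_sub_cancel_left, smul_mul_assoc]
  by_cases h0 : μ i = 0
  · simp [h0]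
  have hμi : (μ - Pi.single i 1) + Pi.single i 1 = μ := by
    funext j
    by_cases hj : j = i
    · subst hj
      simp
      lia
    · simp [hj]
  refine Submodule.smul_mem _ _ (xPow_mul_delPow_mem ?_ ?_)
  · rw [← hμi, sum_add_single] at hμ
    lia
  · rw [← hα, ← hμi, deg_add, hμi]
    abel

theorem del_mul_mem_homog (i : Fin n) (hP : P ∈ homog A k α) :
    del i * P ∈ homog A k (α + deg A (Pi.single i 1)) := by
  cases k with
  | zero => simp [homog_zero hP]
  | succ k =>
    rw [← sub_add_cancel (del i * P) (P * del i)]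
    exact add_mem (homog_mono k.le_succ (del_commutator_mem_homog i hP)) (mul_del_mem_homog i hP)

theorem mul_delPow_mem_homog (u : Fin n → ℕ) (hP : P ∈ homog A k α) :
    P * delPow u ∈ homog A k (α + deg A u) := by
  induction u using exponent_induction with
  | h0 => simpa using hP
  | hs u i ih =>
    rw [delPow_add, delPow_single, ← mul_assoc, deg_add, ← add_assoc]
    exact mul_del_mem_homog i ih

/-- Leibniz rule for commutators, reducing to a single `∂_i`. -/
theorem delPow_commutator_mem_homog (u : Fin n → ℕ) (hP : P ∈ homog A (k + 1) α) :
    delPow u * P - P * delPow u ∈ homog A k (α + deg A u) := by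
  induction u using exponent_induction with
  | h0 => simp
  | hs u i ih =>
    have h : delPow (u + Pi.single i 1) * P - P * delPow (u + Pi.single i 1) =
        del i * (delPow u * P - P * delPow u) + (del i * P - P * del i) * delPow u := by
      rw [add_comm, delPow_add, delPow_single]
      simp only [mul_sub, sub_mul, mul_assoc]
      abel
    rw [h, deg_add]
    refine add_mem ?_ ?_
    · rw [← add_assoc]
      exact del_mul_mem_homog i ih
    · rw [add_comm (deg A u), ← add_assoc]
      exact mul_delPow_mem_homog u (del_commutator_mem_homog i hP)

/-- Operators of `A`-degree `α` are eigenvectors of the commutator with the Euler operators. -/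
theorem euler_mul_homog (i : Fin d) (hP : P ∈ homog A k α) :
    euler A i * P = P * euler A i - (α i : ℂ) • P := by
  have h := mul_mem_homog (M := ⊥) (LinearMap.mulLeft ℂ (euler A i) -
    LinearMap.mulRight ℂ (euler A i) + (α i : ℂ) • LinearMap.id) (fun μ ν hμ hα => ?_) hP
  · simp only [Submodule.mem_bot, LinearMap.add_apply, LinearMap.sub_apply,
      LinearMap.mulLeft_apply, LinearMap.mulRight_apply, LinearMap.smul_apply,
      LinearMap.id_apply] at h
    rw [eq_comm, sub_eq_iff_eq_add, ← sub_eq_zero, ← neg_eq_zero, ← h]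
    abel
  · have hθ (j : Fin n) : theta j * (xPow μ * delPow ν) =
        xPow μ * delPow ν * theta j - ((ν j : ℂ) - μ j) • (xPow μ * delPow ν) := by
      rw [← mul_assoc, theta_mul_xPow, add_mul, mul_assoc, theta_mul_delPow, mul_sub,
        sub_smul (ν j : ℂ) (μ j : ℂ) (xPow μ * delPow ν), smul_mul_assoc, mul_smul_comm, mul_assoc]
      abel
    have hαi : (α i : ℂ) = ∑ j, (A i j : ℂ) * ((ν j : ℂ) - μ j) := by
      simp [← hα, deg, Matrix.mulVec, dotProduct, mul_sub]
    simp only [Submodule.mem_bot, LinearMap.add_apply, LinearMap.sub_apply,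
      LinearMap.mulLeft_apply, LinearMap.mulRight_apply, LinearMap.smul_apply,
      LinearMap.id_apply, euler, Finset.sum_mul, Finset.mul_sum, smul_mul_assoc, mul_smul_comm,
      hθ, hαi, smul_sub, Finset.sum_sub_distrib, smul_smul, ← Finset.sum_smul]
    abel

theorem euler_sub_mul_homog {β : Fin d → ℂ} (i : Fin d) (hP : P ∈ homog A k α) :
    (euler A i - algebraMap ℂ (Weyl n) (β i - α i)) * P =
      P * (euler A i - algebraMap ℂ (Weyl n) (β i)) := by
  rw [sub_mul, mul_sub, euler_mul_homog i hP, map_sub, sub_mul, ← Algebra.smul_def,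
    ← Algebra.smul_def, ← Algebra.commutes, ← Algebra.smul_def]
  abel

/-- The Weyl algebra is the sum of its homogeneous parts. -/
theorem iSup_homog_eq_top (A : Matrix (Fin d) (Fin n) ℤ) : ⨆ α, ⨆ k, homog A k α = ⊤ := by
  let S := ⨆ α, ⨆ k, homog A k α
  have hmem {α k P} (h : P ∈ homog A k α) : P ∈ S :=
    Submodule.mem_iSup_of_mem α (Submodule.mem_iSup_of_mem k h)
  have hstable (c : Weyl n) (hc : ∀ α k, ∀ P ∈ homog A k α, c * P ∈ S) :
      S ≤ S.comap (LinearMap.mulLeft ℂ c) :=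
    iSup_le fun α => iSup_le fun k P hP => hc α k P hP
  -- The sum is stable under left multiplication by the generators of `D`, hence is a left ideal; it
  -- contains `1`.
  have hmul (Q : Weyl n) : S ≤ S.comap (LinearMap.mulLeft ℂ Q) := by
    obtain ⟨Q, rfl⟩ := RingQuot.mkAlgHom_surjective ℂ (WeylRel n) Q
    induction Q using FreeAlgebra.induction with
    | grade0 r =>
      intro P hP
      simpa [← Algebra.smul_def] using S.smul_mem r hP
    | grade1 x =>
      cases x with
      | inl i => exact hstable (X i) fun α k P hP => hmem (X_mul_mem_homog i hP)
      | inr i => exact hstable (del i) fun α k P hP => hmem (del_mul_mem_homog i hP)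
    | mul a b ha hb =>
      intro P hP
      simpa [mul_assoc] using ha (hb hP)
    | add a b ha hb =>
      intro P hP
      simpa [add_mul] using S.add_mem (ha hP) (hb hP)
  refine eq_top_iff.2 fun P _ => ?_
  have h1 : (1 : Weyl n) ∈ S := by
    simpa using hmem (delPow_mem (A := A) (0 : Fin n → ℕ))
  simpa using hmul P h1

end Homog

/-! ### Inverting `∂^w` modulo `H_A(β)` for nonresonant `β` -/

section Nonresonant

variable {A : Matrix (Fin d) (Fin n) ℤ} {β : Fin d → ℂ}

/-- Nonresonance is invariant under integral translations. -/
theorem Nonresonant.sub_int (hspan : Submodule.span ℤ (Set.range A.transpose) = ⊤)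
    (hβ : Nonresonant A β) (α : Fin d → ℤ) : Nonresonant A fun i => β i - α i := by
  intro σ hσ ν hν k hk
  obtain ⟨u, rfl⟩ := exists_mulVec_eq hspan α
  have h1 : ∑ i, ν i * ((A.mulVec u i : ℤ) : ℚ) ∈ Set.range (fun k : ℤ => (k : ℚ)) :=
    hν.image_eq ▸ Set.mem_range_self _
  obtain ⟨l, hl⟩ := h1
  refine hβ σ hσ ν hν (k + l) ?_
  have hl' := congrArg (fun q : ℚ => (q : ℂ)) hl
  push_cast at hl' ⊢
  rw [hl', ← hk, ← Finset.sum_add_distrib]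
  exact Finset.sum_congr rfl fun i _ => by ring

/-- For nonresonant `β`, right multiplication by `∂^w` is surjective onto `D / H_A(β)`. -/
theorem exists_mul_delPow_sub_one_mem (hspan : Submodule.span ℤ (Set.range A.transpose) = ⊤)
    (hβ : Nonresonant A β) (w : Fin n → ℕ) :
    ∃ Q : Weyl n, Q * delPow w - 1 ∈ hypergeometricIdeal A β := by
  let J : Ideal (Weyl n) := Ideal.span {delPow w} ⊔ hypergeometricIdeal A β
  have hJ : (1 : Weyl n) ∈ J := by
    -- Pull back to commutative polynomials in `θ`: by the Nullstellensatz it suffices that the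
    -- pullback has no zero. The Euler polynomials put any zero on `A z = β`.
    let a : Ideal (MvPolynomial (Fin n) ℂ) := Ideal.comap thetaEval J
    suffices h : a = ⊤ by
      have h1 : (1 : MvPolynomial (Fin n) ℂ) ∈ a := h ▸ Submodule.mem_top
      simpa [a] using h1
    have hzero : MvPolynomial.zeroLocus ℂ a = ∅ := by
      refine Set.eq_empty_of_forall_notMem fun z hz => ?_
      rw [MvPolynomial.mem_zeroLocus_iff] at hz
      have hzβ : weight A z = β := by
        funext i
        have h1 : eulerPoly A β i ∈ a := by
          rw [Ideal.mem_comap, thetaEval_eulerPoly]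
          exact Submodule.mem_sup_right (euler_sub_mem i)
        have h2 := hz _ h1
        rw [MvPolynomial.aeval_eq_eval] at h2
        exact sub_eq_zero.1 ((eval_eulerPoly z i).symm.trans h2)
      obtain ⟨c, e, hc, he, hce⟩ := exists_positive_relation hspan hβ hzβ
      -- As `e ≥ 1`, `N e ≥ w` coordinatewise, so `∂^(Ne)`, and with it `∂^(Nc)`, lies in `J`. Then
      -- `x^(Nc) ∂^(Nc) = p(θ)` lies in `J`, although `p z ≠ 0`.
      let N := ∑ j, w j
      obtain ⟨p, hp, hpz⟩ := exists_xPow_mul_delPow_eq (N • c)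
      refine hpz z (fun k hk => hc k fun h => hk (by simp [h])) ?_
      have hpa : p ∈ a := by
        rw [Ideal.mem_comap, ← hp]
        have hw : (N • e - w) + w = N • e := by
          funext j
          have h1 : w j ≤ N := Finset.single_le_sum (f := w) (fun _ _ => Nat.zero_le _)
            (Finset.mem_univ j)
          have h2 := Nat.mul_le_mul_left N (he j)
          simp only [Pi.add_apply, Pi.sub_apply, Pi.smul_apply, smul_eq_mul]
          lia
        have h1 : delPow (N • e) ∈ J := by
          rw [← hw, delPow_add]
          exact J.mul_mem_left _ (Submodule.mem_sup_left (Ideal.mem_span_singleton_self _))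
        have h2 : delPow (N • c) - delPow (N • e) ∈ J :=
          Submodule.mem_sup_right (binomial_mem (by rw [deg_nsmul, deg_nsmul, hce]))
        have h3 : delPow (N • c) ∈ J := by simpa using J.add_mem h2 h1
        exact J.mul_mem_left _ h3
      have h2 := hz _ hpa
      rwa [MvPolynomial.aeval_eq_eval] at h2
    have hrad := MvPolynomial.vanishingIdeal_zeroLocus_eq_radical (K := ℂ) a
    rw [hzero, MvPolynomial.vanishingIdeal_empty] at hrad
    exact Ideal.radical_eq_top.1 hrad.symm
  obtain ⟨P, hP, Q, hQ, hPQ⟩ := Submodule.mem_sup.1 hJ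
  obtain ⟨R, rfl⟩ := Ideal.mem_span_singleton'.1 hP
  refine ⟨R, ?_⟩
  rw [← hPQ, sub_add_cancel_left]
  exact neg_mem hQ

/-! ### Supports of solutions -/

theorem IsSolution.weight_eq {g : Series n} (hg : IsSolution (hypergeometricIdeal A β) g)
    {w : Fin n → ℂ} (hw : g w ≠ 0) : weight A w = β := by
  funext i
  have h := congrFun (hg _ (euler_sub_mem i)) w
  rw [map_sub, AlgHom.commutes, LinearMap.sub_apply, Pi.sub_apply, action_euler,
    Module.algebraMap_end_apply, Pi.smul_apply, smul_eq_mul, ← sub_mul] at h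
  exact sub_eq_zero.1 ((mul_eq_zero.1 h).resolve_right hw)

/-- Compare the coefficients of `x^w` in `x^a ∂^a g = x^a ∂^b g`: the left one is a nonzero multiple
of `g w`, the right one a multiple of the shifted coefficient. -/
theorem IsSolution.shift_ne_zero {g : Series n} (hg : IsSolution (hypergeometricIdeal A β) g)
    {w : Fin n → ℂ} (hw : g w ≠ 0) {a b : Fin n → ℕ} (hab : deg A a = deg A b)
    (ha : ∀ k, a k ≠ 0 → ∀ m : ℤ, w k ≠ m) : g (fun j => w j - a j + b j) ≠ 0 := by
  obtain ⟨p, hp, hpz⟩ := exists_xPow_mul_delPow_eq a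
  have h : action n (delPow a) g = action n (delPow b) g := by
    rw [← sub_eq_zero, ← LinearMap.sub_apply, ← map_sub]
    exact hg _ (binomial_mem hab)
  have h1 := congrFun (congrArg (action n (xPow a)) h) w
  rw [← Module.End.mul_apply, ← map_mul, hp, action_thetaEval, action_xPow] at h1
  obtain ⟨s, hs⟩ := action_delPow b g fun j => w j - a j
  rw [hs] at h1
  exact right_ne_zero_of_mul (h1 ▸ mul_ne_zero (hpz w ha) hw)

/-- A polynomial vanishing on the support of a solution vanishes on all translates of a point of
the support by the integral kernel of `A`. -/
theorem IsSolution.eval_add_eq_zero (hspan : Submodule.span ℤ (Set.range A.transpose) = ⊤)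
    (hβ : Nonresonant A β) {g : Series n} (hg : IsSolution (hypergeometricIdeal A β) g)
    {q : MvPolynomial (Fin n) ℂ} (hq : ∀ w, g w ≠ 0 → MvPolynomial.eval w q = 0)
    {w : Fin n → ℂ} (hw : g w ≠ 0) {l : Fin n → ℤ} (hl : A.mulVec l = 0) :
    MvPolynomial.eval (fun j => w j + l j) q = 0 := by
  classical
  obtain ⟨c, e, hc, he, hce⟩ := exists_positive_relation hspan hβ (hg.weight_eq hw)
  -- Restrict `q` to the line `w + l + t (e - c)`. All large integers `t` give support points, so `r
  -- = 0`; then take `t = 0`.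
  let r : Polynomial ℂ := MvPolynomial.aeval
    (fun j => Polynomial.C (w j + l j) + Polynomial.C ((e j : ℂ) - c j) * Polynomial.X) q
  have hr (t : ℂ) : r.eval t =
      MvPolynomial.eval (fun j => w j + l j + ((e j : ℂ) - c j) * t) q := by
    rw [← Polynomial.coe_aeval_eq_eval, ← MvPolynomial.aeval_eq_eval]
    simp only [r, ← AlgHom.comp_apply, MvPolynomial.comp_aeval]
    simp
  have hroot (t : ℕ) (ht : ∑ j, (l j).natAbs ≤ t) : r.eval (t : ℂ) = 0 := by
    -- Here `b - a = l + t (e - c)`, with `m` cancelling. Both `c` and `m` live on nonintegral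
    -- coordinates, as the shift lemma requires.
    let m : Fin n → ℕ := fun j => if ∀ m : ℤ, w j ≠ m then (-l j).toNat else 0
    let a : Fin n → ℕ := fun j => t * c j + m j
    have hpos (j : Fin n) : 0 ≤ l j + t * e j + m j := by
      have h1 : (l j).natAbs ≤ ∑ j, (l j).natAbs :=
        Finset.single_le_sum (f := fun j => (l j).natAbs) (fun _ _ => Nat.zero_le _)
          (Finset.mem_univ j)
      have h2 := Nat.mul_le_mul_left t (he j)
      have h3 : ((t * e j : ℕ) : ℤ) = t * e j := by push_cast; rfl
      lia
    let b : Fin n → ℕ := fun j => (l j + t * e j + m j).toNat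
    have hb (j : Fin n) : (b j : ℤ) = l j + t * e j + m j := Int.toNat_of_nonneg (hpos j)
    have hbC (j : Fin n) : (b j : ℂ) = l j + t * e j + m j := by exact_mod_cast hb j
    have hab : deg A a = deg A b := by
      have h1 : (fun j => (b j : ℤ)) = l + (t : ℤ) • (fun j => (e j : ℤ)) + fun j => (m j : ℤ) :=
        funext hb
      have h2 : (fun j => (a j : ℤ)) = (t : ℤ) • (fun j => (c j : ℤ)) + fun j => (m j : ℤ) := by
        funext j
        simp [a]
      rw [deg, deg, h1, h2, Matrix.mulVec_add, Matrix.mulVec_add, Matrix.mulVec_add, hl,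
        Matrix.mulVec_smul, Matrix.mulVec_smul, zero_add]
      exact congrArg (fun v => (t : ℤ) • v + _) hce
    have ha (k : Fin n) (hk : a k ≠ 0) (m' : ℤ) : w k ≠ m' := by
      by_contra h
      have h1 : c k = 0 := by
        by_contra h0
        exact hc k h0 m' h
      have h2 : ¬∀ m : ℤ, w k ≠ m := fun h0 => h0 m' h
      exact hk (by simp [a, m, h1, h2])
    rw [hr, ← hq _ (hg.shift_ne_zero hw hab ha)]
    congr 2
    funext j
    simp only [hbC, a]
    push_cast
    ring
  have hr0 : r = 0 := by
    refine Polynomial.eq_zero_of_infinite_isRoot r (Set.Infinite.mono ?_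
      (((Set.Ici_infinite (∑ j, (l j).natAbs)).image
        (Nat.cast_injective (R := ℂ)).injOn)))
    rintro _ ⟨t, ht, rfl⟩
    exact hroot t ht
  have h0 := hr 0
  rw [hr0] at h0
  simpa using h0.symm

theorem weight_sub (A : Matrix (Fin d) (Fin n) ℤ) (z w : Fin n → ℂ) :
    weight A (z - w) = weight A z - weight A w := by
  funext i
  simp [weight, mul_sub]

theorem weight_intCast (A : Matrix (Fin d) (Fin n) ℤ) (u : Fin n → ℤ) (i : Fin d) :
    weight A (fun j => (u j : ℂ)) i = (A.mulVec u i : ℤ) := by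
  simp [weight, Matrix.mulVec, dotProduct]

/-- The support of a nonzero solution is Zariski dense in the fiber `{z | A z = β}`. -/
theorem IsSolution.eval_eq_zero (hspan : Submodule.span ℤ (Set.range A.transpose) = ⊤)
    (hβ : Nonresonant A β) {g : Series n} (hg : IsSolution (hypergeometricIdeal A β) g)
    (hg0 : g ≠ 0) {q : MvPolynomial (Fin n) ℂ}
    (hq : ∀ w, g w ≠ 0 → MvPolynomial.eval w q = 0)
    {z : Fin n → ℂ} (hz : weight A z = β) : MvPolynomial.eval z q = 0 := by
  obtain ⟨w, hw⟩ := Function.ne_iff.1 hg0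
  choose b hb using fun i => exists_mulVec_eq hspan (Pi.single i 1)
  -- With `b` an integral right inverse of `A`, `s ↦ w + (s - b A s)` maps into the fiber and sends
  -- integral `s` to translates of `w` by the integral kernel. So `r` vanishes on `ℤ^n`, hence
  -- everywhere, in particular at `z - w`.
  let r : MvPolynomial (Fin n) ℂ := MvPolynomial.aeval (fun j => MvPolynomial.C (w j) +
    (MvPolynomial.X j - ∑ i, eulerPoly A 0 i * MvPolynomial.C (b i j : ℂ))) q
  have hr (s : Fin n → ℂ) : MvPolynomial.eval s r =
      MvPolynomial.eval (fun j => w j + (s j - ∑ i, weight A s i * b i j)) q := by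
    rw [← MvPolynomial.aeval_eq_eval, ← MvPolynomial.aeval_eq_eval]
    simp only [r, ← AlgHom.comp_apply, MvPolynomial.comp_aeval]
    simp [MvPolynomial.aeval_eq_eval, eval_eulerPoly]
  have hr0 : r = 0 := by
    refine MvPolynomial.funext_set (fun _ => Set.range fun m : ℤ => (m : ℂ))
      (fun _ => Set.infinite_range_of_injective Int.cast_injective) fun s hs => ?_
    choose u hu using fun j => hs j (Set.mem_univ j)
    obtain rfl : (fun j => (u j : ℂ)) = s := funext hu
    rw [hr, map_zero]
    let l : Fin n → ℤ := u - ∑ i, A.mulVec u i • b i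
    have hl : A.mulVec l = 0 := by
      simp only [l, Matrix.mulVec_sub, Matrix.mulVec_sum, Matrix.mulVec_smul, hb]
      funext i
      simp [Finset.sum_apply, Pi.single_apply]
    rw [← hg.eval_add_eq_zero hspan hβ hq hw hl]
    congr 2
    funext j
    simp [l, weight_intCast]
  have h1 := hr (z - w)
  rw [hr0, map_zero, weight_sub, hz, hg.weight_eq hw, sub_self] at h1
  simpa using h1.symm

/-- A polynomial in `θ` annihilating a nonzero solution lies in the ideal of the Euler
operators. -/
theorem IsSolution.thetaEval_mem (hspan : Submodule.span ℤ (Set.range A.transpose) = ⊤)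
    (hβ : Nonresonant A β) {g : Series n} (hg : IsSolution (hypergeometricIdeal A β) g)
    (hg0 : g ≠ 0) {q : MvPolynomial (Fin n) ℂ} (hq : action n (thetaEval q) g = 0) :
    thetaEval q ∈ hypergeometricIdeal A β := by
  choose b hb using fun i => exists_mulVec_eq hspan (Pi.single i 1)
  let a : Ideal (MvPolynomial (Fin n) ℂ) := Ideal.span (Set.range (eulerPoly A β))
  -- A polynomial retraction onto the fiber: `q ∘ y = 0` by density, while `y_j ≡ X_j` modulo the
  -- Euler polynomials. Hence `q` is in their ideal, with no radical needed.
  let y : Fin n → MvPolynomial (Fin n) ℂ := fun j =>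
    MvPolynomial.X j - ∑ i, eulerPoly A β i * MvPolynomial.C (b i j : ℂ)
  have hqw (w : Fin n → ℂ) (hw : g w ≠ 0) : MvPolynomial.eval w q = 0 := by
    have h := congrFun hq w
    rw [action_thetaEval] at h
    exact (mul_eq_zero.1 h).resolve_right hw
  have hy : MvPolynomial.aeval y q = 0 := by
    refine MvPolynomial.funext fun s => ?_
    have h1 : MvPolynomial.eval s (MvPolynomial.aeval y q) = MvPolynomial.eval
        (s - ∑ i, (weight A s i - β i) • fun j => (b i j : ℂ)) q := by
      rw [← MvPolynomial.aeval_eq_eval, ← MvPolynomial.aeval_eq_eval]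
      simp only [← AlgHom.comp_apply, MvPolynomial.comp_aeval]
      congr 2
      funext j
      simp [y, MvPolynomial.aeval_eq_eval, eval_eulerPoly]
    rw [h1, map_zero]
    refine hg.eval_eq_zero hspan hβ hg0 hqw ?_
    have h2 (i k : Fin d) : weight A (fun j => (b i j : ℂ)) k = if k = i then 1 else 0 := by
      rw [weight_intCast, hb]
      simp [Pi.single_apply]
    funext k
    have h3 : weight A (∑ i, (weight A s i - β i) • fun j => (b i j : ℂ)) k =
        ∑ i, (weight A s i - β i) * weight A (fun j => (b i j : ℂ)) k := by
      simp only [weight, Finset.sum_apply, Pi.smul_apply, smul_eq_mul, Finset.mul_sum]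
      rw [Finset.sum_comm]
      exact Finset.sum_congr rfl fun i _ => Finset.sum_congr rfl fun j _ => by ring
    rw [weight_sub, Pi.sub_apply, h3]
    simp [h2]
  have hmk : (Ideal.Quotient.mkₐ ℂ a).comp (MvPolynomial.aeval y) = Ideal.Quotient.mkₐ ℂ a := by
    refine MvPolynomial.algHom_ext fun j => ?_
    rw [AlgHom.comp_apply, MvPolynomial.aeval_X, ← sub_eq_zero, ← map_sub,
      Ideal.Quotient.mkₐ_eq_mk, Ideal.Quotient.eq_zero_iff_mem]
    simp only [y, sub_sub_cancel_left]
    exact neg_mem (sum_mem fun i _ => Ideal.mul_mem_right _ _ (Ideal.subset_span ⟨i, rfl⟩))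
  have hqa : q ∈ a := by
    have h := DFunLike.congr_fun hmk q
    rw [AlgHom.comp_apply, hy, map_zero] at h
    exact Ideal.Quotient.eq_zero_iff_mem.1 h.symm
  have ha : a ≤ Ideal.comap thetaEval (hypergeometricIdeal A β) := by
    refine Ideal.span_le.2 ?_
    rintro _ ⟨i, rfl⟩
    rw [SetLike.mem_coe, Ideal.mem_comap, thetaEval_eulerPoly]
    exact euler_sub_mem i
  exact ha hqa

/-! ### Homogeneous annihilating operators -/

/-- Modulo the toric ideal, `∂^w` times a homogeneous operator is of the form `q(θ) ∂^u`. -/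
theorem exists_delPow_mul_sub_mem {k : ℕ} {α : Fin d → ℤ} {P : Weyl n} (hP : P ∈ homog A k α)
    {u : Fin n → ℕ} (hu : deg A u = deg A (fun _ => k) + α) :
    ∃ q, delPow (fun _ => k) * P - thetaEval q * delPow u ∈ hypergeometricIdeal A β := by
  induction hP using Submodule.span_induction with
  | mem P hP =>
    obtain ⟨μ, ν, hμ, hα, rfl⟩ := hP
    -- Total degree below `k` gives `μ ≤ (k, …, k)`, so `∂^(k,…,k)` absorbs `x^μ`; a binomial then
    -- trades the remaining `∂`-monomial for `∂^u`.
    have hk : (fun _ => k) - μ + μ = fun _ => k := by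
      funext j
      have h1 : μ j ≤ ∑ j, μ j :=
        Finset.single_le_sum (f := μ) (fun _ _ => Nat.zero_le _) (Finset.mem_univ j)
      simp only [Pi.add_apply, Pi.sub_apply]
      lia
    obtain ⟨q, hq⟩ := exists_delPow_mul_xPow ((fun _ => k) - μ) μ
    rw [hk] at hq
    refine ⟨q, ?_⟩
    rw [← mul_assoc, hq, mul_assoc, ← delPow_add, ← mul_sub]
    refine Ideal.mul_mem_left _ _ (binomial_mem ?_)
    have h2 := congrArg (deg A) hk
    rw [deg_add] at h2
    rw [hu, ← hα, ← h2, deg_add]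
    abel
  | zero => exact ⟨0, by simp⟩
  | add P Q _ _ hP hQ =>
    obtain ⟨p, hp⟩ := hP
    obtain ⟨q, hq⟩ := hQ
    refine ⟨p + q, ?_⟩
    convert! add_mem hp hq using 1
    rw [map_add, mul_add, add_mul]
    abel
  | smul c P _ hP =>
    obtain ⟨p, hp⟩ := hP
    refine ⟨c • p, ?_⟩
    convert! Ideal.mul_mem_left _ (algebraMap ℂ (Weyl n) c) hp using 1
    rw [← Algebra.smul_def, smul_sub, map_smul, mul_smul_comm, smul_mul_assoc]

theorem homog_eq_zero_of_forall_deg_ne {k : ℕ} {α : Fin d → ℤ} {P : Weyl n}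
    (hP : P ∈ homog A k α) (h : ∀ u, deg A u ≠ deg A (fun _ => k) + α) : P = 0 := by
  have : homog A k α = ⊥ := Submodule.span_eq_bot.2 (by
    rintro _ ⟨μ, ν, hμ, hα, -⟩
    have hk : (fun _ => k) - μ + μ = fun _ => k := by
      funext j
      have h1 : μ j ≤ ∑ j, μ j :=
        Finset.single_le_sum (f := μ) (fun _ _ => Nat.zero_le _) (Finset.mem_univ j)
      simp only [Pi.add_apply, Pi.sub_apply]
      lia
    refine absurd ?_ (h ((fun _ => k) - μ + ν))
    have h2 := congrArg (deg A) hk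
    rw [deg_add] at h2
    rw [← hα, ← h2, deg_add]
    abel)
  simpa [this] using hP

/-- `∂^u` commutes with the toric binomials and shifts the Euler parameters by `Au`. -/
theorem mul_delPow_mem {u : Fin n → ℕ} {P : Weyl n}
    (hP : P ∈ hypergeometricIdeal A fun i => β i - deg A u i) :
    P * delPow u ∈ hypergeometricIdeal A β := by
  refine mul_mem_of_generators (fun a b hab => ?_) (fun i => ?_) hP
  · have h : (delPow a - delPow b) * delPow u = delPow u * (delPow a - delPow b) := by
      simp only [sub_mul, mul_sub, ← delPow_add, add_comm]
    rw [h]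
    exact Ideal.mul_mem_left _ _ (binomial_mem hab)
  · rw [euler_sub_mul_homog i (delPow_mem u)]
    exact Ideal.mul_mem_left _ _ (euler_sub_mem i)

theorem thetaEval_mul_delPow_mem (hspan : Submodule.span ℤ (Set.range A.transpose) = ⊤)
    (hβ : Nonresonant A β) {f : Series n} (hf : IsSolution (hypergeometricIdeal A β) f)
    (hf0 : f ≠ 0) {q : MvPolynomial (Fin n) ℂ} {u : Fin n → ℕ}
    (hq : action n (thetaEval q * delPow u) f = 0) :
    thetaEval q * delPow u ∈ hypergeometricIdeal A β := by
  have hg : IsSolution (hypergeometricIdeal A fun i => β i - deg A u i)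
      (action n (delPow u) f) := fun P hP => by
    rw [← Module.End.mul_apply, ← map_mul]
    exact hf _ (mul_delPow_mem hP)
  -- A left inverse of `∂^u` modulo `H_A(β)` recovers `f` from `∂^u f`.
  have hg0 : action n (delPow u) f ≠ 0 := fun h0 => by
    obtain ⟨Q, hQ⟩ := exists_mul_delPow_sub_one_mem hspan hβ u
    have h1 := hf _ hQ
    rw [map_sub, map_mul, map_one, LinearMap.sub_apply, Module.End.mul_apply, h0, map_zero,
      zero_sub, Module.End.one_apply, neg_eq_zero] at h1
    exact hf0 h1
  rw [map_mul, Module.End.mul_apply] at hq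
  exact mul_delPow_mem (hg.thetaEval_mem hspan (hβ.sub_int hspan _) hg0 hq)

/-- Homogeneous operators annihilating a nonzero solution of `H_A(β)` lie in `H_A(β)`. -/
theorem mem_of_homog_of_action_eq_zero
    (hspan : Submodule.span ℤ (Set.range A.transpose) = ⊤) (hβ : Nonresonant A β)
    {f : Series n} (hf : IsSolution (hypergeometricIdeal A β) f) (hf0 : f ≠ 0) {k : ℕ}
    {α : Fin d → ℤ} {P : Weyl n} (hP : P ∈ homog A k α) (hPf : action n P f = 0) :
    P ∈ hypergeometricIdeal A β := by
  induction k generalizing α P with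
  -- The bound on the `x`-degree is strict, so level `0` contains only `P = 0`.
  | zero => simp [homog_zero hP]
  | succ k ih =>
    have hmul {Q : Weyl n} (hQ : Q ∈ hypergeometricIdeal A fun i => β i - α i) :
        Q * P ∈ hypergeometricIdeal A β := by
      refine mul_mem_of_generators (fun u v huv => ?_) (fun i => ?_) hQ
      · have h1 : P * (delPow u - delPow v) ∈ hypergeometricIdeal A β :=
          Ideal.mul_mem_left _ _ (binomial_mem huv)
        have h2 : (delPow u - delPow v) * P - P * (delPow u - delPow v) ∈
            hypergeometricIdeal A β := by
          refine ih (α := α + deg A u) ?_ ?_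
          · have h3 := delPow_commutator_mem_homog v hP
            rw [← huv] at h3
            convert! sub_mem (delPow_commutator_mem_homog u hP) h3 using 1
            rw [sub_mul, mul_sub]
            abel
          · rw [map_sub, LinearMap.sub_apply, hf _ h1, map_mul, Module.End.mul_apply, hPf,
              map_zero, sub_zero]
        simpa using add_mem h2 h1
      · rw [euler_sub_mul_homog i hP]
        exact Ideal.mul_mem_left _ _ (euler_sub_mem i)
    -- If no `u` has the required degree, no monomial can occur in `P`, so `P = 0`.
    by_cases hu : ∃ u, deg A u = deg A (fun _ => k + 1) + α
    · obtain ⟨u, hu⟩ := hu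
      obtain ⟨q, hq⟩ := exists_delPow_mul_sub_mem (β := β) hP hu
      have h1 : action n (thetaEval q * delPow u) f = 0 := by
        have h2 := hf _ hq
        rwa [map_sub, LinearMap.sub_apply, map_mul, Module.End.mul_apply, hPf, map_zero, zero_sub,
          neg_eq_zero] at h2
      have h3 : delPow (fun _ => k + 1) * P ∈ hypergeometricIdeal A β := by
        simpa using add_mem hq (thetaEval_mul_delPow_mem hspan hβ hf hf0 h1)
      obtain ⟨Q, hQ⟩ := exists_mul_delPow_sub_one_mem hspan (hβ.sub_int hspan α) fun _ => k + 1
      have h4 := sub_mem (Ideal.mul_mem_left _ Q h3) (hmul hQ)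
      rwa [sub_mul, one_mul, mul_assoc, sub_sub_cancel] at h4
    · push Not at hu
      simp [homog_eq_zero_of_forall_deg_ne hP hu]

/-- A homogeneous operator of degree `α` maps solutions of `H_A(β)` to series of weight
`β - α`. -/
theorem IsSolution.weight_eq_of_action_ne_zero {f : Series n}
    (hf : IsSolution (hypergeometricIdeal A β) f) {k : ℕ} {α : Fin d → ℤ} {P : Weyl n}
    (hP : P ∈ homog A k α) {w : Fin n → ℂ} (hw : action n P f w ≠ 0) (i : Fin d) :
    weight A w i = β i - α i := by
  have h := hf _ (Ideal.mul_mem_left _ P (euler_sub_mem (A := A) (β := β) i))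
  rw [← euler_sub_mul_homog i hP, map_mul, Module.End.mul_apply, map_sub, AlgHom.commutes,
    LinearMap.sub_apply] at h
  have h1 := congrFun h w
  rw [Pi.sub_apply, action_euler, Module.algebraMap_end_apply, Pi.smul_apply, smul_eq_mul,
    ← sub_mul] at h1
  exact sub_eq_zero.1 ((mul_eq_zero.1 h1).resolve_right hw)

/-- For nonresonant `β`, the annihilator of a nonzero solution of `H_A(β)` is `H_A(β)`. -/
theorem mem_of_action_eq_zero (hspan : Submodule.span ℤ (Set.range A.transpose) = ⊤)
    (hβ : Nonresonant A β) {f : Series n} (hf : IsSolution (hypergeometricIdeal A β) f)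
    (hf0 : f ≠ 0) {P : Weyl n} (hP : action n P f = 0) : P ∈ hypergeometricIdeal A β := by
  have htop : P ∈ ⨆ α, ⨆ k, homog A k α := iSup_homog_eq_top A ▸ Submodule.mem_top
  obtain ⟨c, hc, rfl⟩ := (Submodule.mem_iSup_iff_exists_finsupp _ _).1 htop
  have hdeg (α : Fin d → ℤ) : ∃ k, c α ∈ homog A k α :=
    (Submodule.mem_iSup_of_directed _
      (Monotone.directed_le fun _ _ h => homog_mono h)).1 (hc α)
  refine sum_mem fun α hα => ?_
  obtain ⟨k, hk⟩ := hdeg α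
  refine mem_of_homog_of_action_eq_zero hspan hβ hf hf0 hk ?_
  funext w
  by_contra hw
  have hP' := congrFun hP w
  rw [Finsupp.sum, map_sum, LinearMap.sum_apply, Finset.sum_apply,
    Finset.sum_eq_single_of_mem α hα] at hP'
  · exact hw hP'
  · intro γ _ hγ
    by_contra hwγ
    obtain ⟨l, hl⟩ := hdeg γ
    refine hγ (funext fun i => ?_)
    have h1 := hf.weight_eq_of_action_ne_zero hk hw i
    rw [hf.weight_eq_of_action_ne_zero hl hwγ i, sub_right_inj] at h1
    exact_mod_cast h1

end Nonresonant

/-- The Zariski closure of the empty support is empty, whereas that of `v + L` contains `v`. -/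
theorem FullySupported.ne_zero {f : Series n} (hf : FullySupported f) : f ≠ 0 := by
  rintro rfl
  obtain ⟨v, L, -, h⟩ := hf
  have hv : v ∈ zariskiClosure (translate v L) := by
    refine MvPolynomial.zeroLocus_vanishingIdeal_le _ ⟨0, L.zero_mem, ?_⟩
    funext j
    simp
  rw [← h, Function.support_zero, zariskiClosure, MvPolynomial.vanishingIdeal_empty,
    MvPolynomial.zeroLocus_top] at hv
  exact hv

end AHyp

end

theorem theorem2p5 {d n : ℕ} (A : Matrix (Fin d) (Fin n) ℤ)
    -- the columns of `A` span `ℤ^d` over `ℤ` (so `A` has full rank `d`)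
    (hspan : Submodule.span ℤ (Set.range A.transpose) = ⊤)
    -- the columns of `A` lie in an open half space of `ℝ^d`
    (hhalf : ∃ h : Fin d → ℝ, ∀ j, 0 < ∑ i, h i * (A i j : ℝ))
    (β : Fin d → ℂ) (hβ : AHyp.Nonresonant A β)
    (f : AHyp.Series n) (hf : AHyp.IsSolution (AHyp.hypergeometricIdeal A β) f)
    (hfull : AHyp.FullySupported f) :
    (∀ P : AHyp.Weyl n, AHyp.action n P f = 0 → P ∈ AHyp.hypergeometricIdeal A β) ∧
      AHyp.hypergeometricIdeal A β = AHyp.annihilator f := by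
  have hle (P : AHyp.Weyl n) (hP : AHyp.action n P f = 0) : P ∈ AHyp.hypergeometricIdeal A β :=
    AHyp.mem_of_action_eq_zero hspan hβ hf hfull.ne_zero hP
  exact ⟨hle, le_antisymm (fun P hP => hf P hP) hle⟩
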